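/- Let $\mathcal A=\mathcal A_1\times\dots\times\mathcal A_N$ be a product of compact allocation sets, let $B,L\ge 0$, and let $\sigma(t)=1/(1+e^{-t})$. Suppose that agent $i\in[N]$ has the cost $c_i(a)=\langle\theta_i^*,\phi_i(a)\rangle$, where $\|\theta_i^*\|\le B$, $\phi_i:\mathcal A\to\mathbb R^d$ is continuous with $\|\phi_i(a)\|\le L$ for all $a$, and the differences $\phi_i(a)-\phi_i(a')$ span $\mathbb R^d$; her utility is $u_i=p_i-c_i$ with a payment function $p_i:\mathcal A\to\mathbb R$. Let $\mathcal X_i=\{\phi_i(a')-\phi_i(a):a,a'\in\mathcal A\}$ and $\kappa_i=\max_{\|\theta\|\le B,\,x\in\mathcal X_i}1/\sigma'(\langle\theta,x\rangle)$ (which is at most $1/\sigma'(2BL)$). Let $K>d(d+1)/2$ and $0<\delta<1$. For each agent $i$ the planner selects $K$ queries $(a_{i,k},a'_{i,k})$ by a D-optimal design: for a probability measure $\pi_i^*$ on $\mathcal X_i$ that is supported on at most $d(d+1)/2$ points and maximizes $\log\det\int xx^\top d\pi(x)$ over all probability measures $\pi$ on $\mathcal X_i$, each comparison $x\in\mathcal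 X_i$ is queried at least $\lceil (K-d(d+1)/2)\,\pi_i^*(x)\rceil$ times, i.e. $x_{i,k}:=\phi_i(a'_{i,k})-\phi_i(a_{i,k})$ equals $x$ for at least that many $k$ (these numbers add up to at most $K$; any remaining queries are arbitrary). The two alternatives of a query carry equal payments, $p_i(a_{i,k})=p_i(a'_{i,k})$. The feedback is truthful: for each $i$ the labels $\bar y_{i,k}\in\{0,1\}$, $k\le K$, are independent, and $\bar y_{i,k}=1$ with the Bradley–Terry probability $\sigma(u_i(a_{i,k})-u_i(a'_{i,k}))$. Let $\hat\theta_i$ be a minimizer over $\|\theta\|\le B$ of the negative log-likelihood $-\sum_{k}\bigl[\bar y_{i,k}\log\sigma(\langle\theta,x_{i,k}\rangle)+(1-\bar y_{i,k})\log\sigma(-\langle\theta,x_{i,k}\rangle)\bigr]$, and let $\hat c_i(a)=\langle\hat\theta_i,\phi_i(a)\rangle$. Then for each agent $i$, with probability at least $1-\delta$, $$\bigl|(c_i(a)-c_i(a'))-(\hat c_i(a)-\hat c_i(a'))\bigr|\le\epsilon_{i,K}(\delta)\qquad\text{for all }a,a'\in\mathcal A,$$ where, with an absolute constant $C$ (and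 with the second summand in the bracket read as $0$ if $d=0$), $$\epsilon_{i,K}(\delta)=C\sqrt{\kappa_i\Bigl[\log\tfrac1\delta+d\log\max\Bigl\{e,\tfrac{4eBL(K-1)}{d}\Bigr\}\Bigr]}\,\sqrt{\frac dK}.$$ In particular $\epsilon_{i,K}(\delta)=\tilde{\mathcal O}\bigl(d\sqrt{\log(1/\delta)/K}\bigr)$: there is a constant $M$ that depends only on $B$ and $L$ such that $\epsilon_{i,K}(\delta)\le M\sqrt{\kappa_i}\;d\sqrt{\log(1/\delta)/K}\,\sqrt{\log K}$ for all $d$, all $K>d(d+1)/2$ and all $0<\delta\le 1/2$. -/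

import Mathlib

open MeasureTheory ProbabilityTheory

noncomputable section

/-- The linear cost with parameter `θ` and feature map `φ`: the allocation `a` costs `⟨θ, φ a⟩`.
With an estimated parameter in place of `θ` this is the estimated cost. -/
def linearCost {A : Type*} {d : ℕ} (θ : EuclideanSpace ℝ (Fin d))
    (φ : A → EuclideanSpace ℝ (Fin d)) (a : A) : ℝ :=
  inner ℝ θ (φ a)

/-- The linear-cost assumption for one agent: bounded parameter, continuous and bounded features,
whose differences span the whole space. -/
structure LinearCostAssumption {A : Type*} [TopologicalSpace A] {d : ℕ} (B L : ℝ)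
    (θ : EuclideanSpace ℝ (Fin d)) (φ : A → EuclideanSpace ℝ (Fin d)) : Prop where
  norm_param_le : ‖θ‖ ≤ B
  continuous_feature : Continuous φ
  span_differences : Submodule.span ℝ {x | ∃ a a', x = φ a - φ a'} = ⊤
  norm_feature_le : ∀ a, ‖φ a‖ ≤ L

/-- The feature vector of the query "`q.1` or `q.2`?". It is oriented so that the inner product
with the cost parameter is the cost of `q.2` minus the cost of `q.1`, the log-odds of
preferring `q.1`. -/
def queryFeature {A : Type*} {d : ℕ} (φ : A → EuclideanSpace ℝ (Fin d)) (q : A × A) :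
    EuclideanSpace ℝ (Fin d) :=
  φ q.2 - φ q.1

/-- The design space: the feature vectors of all possible queries. -/
def querySpace {A : Type*} {d : ℕ} (φ : A → EuclideanSpace ℝ (Fin d)) :
    Set (EuclideanSpace ℝ (Fin d)) :=
  Set.range (queryFeature φ)

/-- The theoretical design matrix `V(π) = ∫ x xᵀ dπ(x)`. -/
def designMatrix {d : ℕ} (π : Measure (EuclideanSpace ℝ (Fin d))) : Matrix (Fin d) (Fin d) ℝ :=
  Matrix.of fun i j => ∫ x, x i * x j ∂π

/-- `log det V(π)`, with value `-∞` (`⊥`) if `V(π)` is singular. -/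
def logDetDesign {d : ℕ} (π : Measure (EuclideanSpace ℝ (Fin d))) : EReal :=
  ENNReal.log (ENNReal.ofReal (designMatrix π).det)

/-- `π` is a D-optimal design on `X`: it maximizes `log det V` among all probability measures
supported on `X`. -/
structure IsDOptimalDesign {d : ℕ} (X : Set (EuclideanSpace ℝ (Fin d)))
    (π : Measure (EuclideanSpace ℝ (Fin d))) : Prop where
  isProbabilityMeasure : IsProbabilityMeasure π
  supported : π Xᶜ = 0
  optimal : ∀ ρ : Measure (EuclideanSpace ℝ (Fin d)), IsProbabilityMeasure ρ → ρ Xᶜ = 0 →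
    logDetDesign ρ ≤ logDetDesign π

/-- `q` is a possible output of the subroutine D-Optimal-Design(`K`): for some D-optimal design
`π` supported on at most `d(d+1)/2` points and `n = K - d(d+1)/2`, each comparison `x` is queried
(at least) `⌈n π(x)⌉` times. These numbers add up to at most `K`; if they add up to less, the
remaining queries are arbitrary. -/
def IsDOptimalQueries {A : Type*} {d : ℕ} (φ : A → EuclideanSpace ℝ (Fin d)) {K : ℕ}
    (q : Fin K → A × A) : Prop :=
  ∃ π : Measure (EuclideanSpace ℝ (Fin d)),
    IsDOptimalDesign (querySpace φ) π ∧
    (∃ S : Finset (EuclideanSpace ℝ (Fin d)),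
      S.card ≤ d * (d + 1) / 2 ∧ π (S : Set (EuclideanSpace ℝ (Fin d)))ᶜ = 0) ∧
    ∀ x, ⌈((K - d * (d + 1) / 2 : ℕ) : ℝ) * π.real {x}⌉₊ ≤
      Nat.card {k : Fin K // queryFeature φ (q k) = x}

/-- Truthful feedback under the Bradley--Terry model of an agent with utility `u`: the labels are
independent, and the label of the query `(a, a')` is `true` (`a` is preferred to `a'`) with
probability `σ(u a - u a')`. -/
structure IsTruthfulFeedback {A Ω : Type*} [MeasurableSpace Ω] (μ : Measure Ω) (u : A → ℝ)
    {K : ℕ} (q : Fin K → A × A) (y : Fin K → Ω → Bool) : Prop where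
  measurable : ∀ k, Measurable (y k)
  indep : iIndepFun y μ
  prob : ∀ k, μ.real {ω | y k ω = true} = Real.sigmoid (u (q k).1 - u (q k).2)

/-- The negative log-likelihood of the data `(x k, y k)`, as a function of `θ`. -/
def negLogLikelihood {d K : ℕ} (x : Fin K → EuclideanSpace ℝ (Fin d)) (y : Fin K → Bool)
    (θ : EuclideanSpace ℝ (Fin d)) : ℝ :=
  -∑ k, if y k then Real.log (Real.sigmoid (inner ℝ θ (x k)))
    else Real.log (Real.sigmoid (-inner ℝ θ (x k)))

/-- `θ` minimizes the negative log-likelihood over the ball of radius `B`. -/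
def IsMLE {d K : ℕ} (B : ℝ) (x : Fin K → EuclideanSpace ℝ (Fin d)) (y : Fin K → Bool)
    (θ : EuclideanSpace ℝ (Fin d)) : Prop :=
  ‖θ‖ ≤ B ∧ ∀ θ', ‖θ'‖ ≤ B → negLogLikelihood x y θ ≤ negLogLikelihood x y θ'

/-- The maximum `κ` of `1 / σ'(⟨θ, x⟩)` over `‖θ‖ ≤ B` and `x ∈ X`. -/
def kappa {d : ℕ} (B : ℝ) (X : Set (EuclideanSpace ℝ (Fin d))) : ℝ :=
  sSup {r | ∃ θ x : EuclideanSpace ℝ (Fin d), ‖θ‖ ≤ B ∧ x ∈ X ∧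
    r = 1 / deriv Real.sigmoid (inner ℝ θ x)}

/-- The radius `γ_K(δ)` of the confidence set for the parameter (up to a constant factor). -/
def confidenceRadius (B L κ : ℝ) (d K : ℕ) (δ : ℝ) : ℝ :=
  √(κ * (Real.log (1 / δ) +
    d * Real.log (max (Real.exp 1) (4 * Real.exp 1 * B * L * ((K : ℝ) - 1) / d))))

/-- The error bound `ε_K(δ) = C γ_K(δ) √(d / K)`, where `C` is a constant. -/
def errorBound (C B L κ : ℝ) (d K : ℕ) (δ : ℝ) : ℝ :=
  C * confidenceRadius B L κ d K δ * √((d : ℝ) / K)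

end

/-! The proof bounds `⟨θ* - θ̂, v⟩` for every comparison `v` by combining three facts.

Curvature: every inner product of a feasible parameter with a comparison lies where `σ' ≥ 1/κ`, so
the loss is strongly convex in the seminorm of the empirical design matrix. The midpoint of `θ*` and
`θ̂` is feasible and cannot beat the minimizer, so the squared distance is at most `4κ` times the
excess loss of `θ*` (`IsMLE.sum_sq_inner_sub_le`). No optimality condition at the boundary of the
ball is needed.

Excess loss: a label vector is bad if some feasible parameter is more than `exp β` times as likely
as `θ*`. Summing over bad vectors, their probability is at most `exp (-β)` times the sum over all
label vectors of a maximal likelihood, the Shtarkov sum. A maximum over the ball is compared with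
the average over a copy of the ball shrunk towards the maximizer by a ratio `r`; since likelihoods
of all label vectors add up to `1`, the sum is at most `(e/r)^d`
(`sum_exp_neg_negLogLikelihood_le`). This is uniform in the parameter, without nets or martingales.

Design: perturbing a D-optimal `π` towards a point mass cannot increase the determinant, which gives
the Kiefer–Wolfowitz bound `⟨w, v⟩² ≤ d ∑ π(x) ⟨w, x⟩²` (`IsDOptimalDesign.sq_inner_le`). The query
counts dominate `n π` with `n = K - d(d+1)/2`, so the right side is at most `d/n` times the
empirical sum of squares.

If `K ≥ d(d+1)` then `n ≥ K/2` and these facts combine. For smaller `K` the bound holds trivially,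
because `|⟨θ, x⟩| ≤ √κ` for feasible `θ`. -/

/-! ### The logistic function and its loss. -/

theorem sigmoid_le_exp_abs_sub_mul (s t : ℝ) :
    Real.sigmoid s ≤ Real.exp |s - t| * Real.sigmoid t := by
  rw [Real.sigmoid_def, Real.sigmoid_def, ← div_eq_mul_inv, inv_eq_one_div,
    div_le_div_iff₀ (by positivity) (by positivity)]
  have h1 : (1 : ℝ) ≤ Real.exp |s - t| := Real.one_le_exp (abs_nonneg _)
  have h2 : Real.exp (-t) ≤ Real.exp |s - t| * Real.exp (-s) := by
    rw [← Real.exp_add]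
    exact Real.exp_le_exp.2 (by linarith [le_abs_self (s - t)])
  linarith

theorem deriv_sigmoid_pos (s : ℝ) : 0 < deriv Real.sigmoid s := by
  simp only [Real.deriv_sigmoid]
  exact mul_pos (Real.sigmoid_pos s) (by linarith [Real.sigmoid_lt_one s])

theorem deriv_sigmoid_neg (s : ℝ) : deriv Real.sigmoid (-s) = deriv Real.sigmoid s := by
  simp only [Real.deriv_sigmoid, Real.sigmoid_neg]
  ring

theorem one_div_deriv_sigmoid (s : ℝ) :
    1 / deriv Real.sigmoid s = 2 + 2 * Real.cosh s := by
  have h : Real.exp s * Real.exp (-s) = 1 := by rw [← Real.exp_add]; simp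
  have h2 : 1 - Real.sigmoid s = (1 + Real.exp s)⁻¹ := by
    rw [← Real.sigmoid_neg, Real.sigmoid_def, neg_neg]
  simp only [Real.deriv_sigmoid]
  rw [h2, Real.sigmoid_def, Real.cosh_eq, ← mul_inv, one_div, inv_inv]
  linear_combination h

/-- Here `2 + 2 cosh s = 4 + 4 sinh² (|s|/2)` and `sinh t ≥ t` for `t ≥ 0`. This makes `√κ` an a
priori bound on inner products, which settles small `K`. -/
theorem sq_le_one_div_deriv_sigmoid (s : ℝ) : s ^ 2 ≤ 1 / deriv Real.sigmoid s := by
  have h := Real.self_le_sinh_iff.2 (show 0 ≤ |s| / 2 by positivity)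
  have h2 := Real.cosh_two_mul (|s| / 2)
  rw [Real.cosh_sq, mul_div_cancel₀ _ two_ne_zero, Real.cosh_abs] at h2
  rw [one_div_deriv_sigmoid, h2, ← sq_abs]
  nlinarith [abs_nonneg s]

theorem hasDerivAt_neg_log_sigmoid (s : ℝ) :
    HasDerivAt (fun s => -Real.log (Real.sigmoid s)) (Real.sigmoid s - 1) s := by
  have h := ((Real.hasDerivAt_sigmoid s).log (Real.sigmoid_pos s).ne').neg
  refine h.congr_deriv ?_
  rw [mul_div_cancel_left₀ _ (Real.sigmoid_pos s).ne']
  ring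

/-- Strong midpoint convexity of the logistic loss. -/
theorem neg_log_sigmoid_midpoint_le {c s t : ℝ}
    (hc : ∀ r ∈ Set.uIcc s t, c ≤ deriv Real.sigmoid r) :
    -Real.log (Real.sigmoid ((s + t) / 2)) ≤
      (-Real.log (Real.sigmoid s) + -Real.log (Real.sigmoid t)) / 2 - c / 8 * (s - t) ^ 2 := by
  -- After subtracting `c/2 * r²` the loss is still convex between `s` and `t`; the midpoint defect
  -- of this quadratic is `c/8 * (s - t)²`.
  have hd (r : ℝ) : HasDerivAt (fun r => -Real.log (Real.sigmoid r) - c / 2 * r ^ 2)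
      (Real.sigmoid r - 1 - c * r) r := by
    have := (hasDerivAt_neg_log_sigmoid r).sub ((hasDerivAt_pow 2 r).const_mul (c / 2))
    refine this.congr_deriv ?_
    simp
    ring
  have hd1 : deriv (fun r => -Real.log (Real.sigmoid r) - c / 2 * r ^ 2) =
      fun r => Real.sigmoid r - 1 - c * r := funext fun r => (hd r).deriv
  have hd2 (r : ℝ) : HasDerivAt (fun r => Real.sigmoid r - 1 - c * r)
      (deriv Real.sigmoid r - c) r := by
    have := ((differentiableAt_sigmoid (x := r)).hasDerivAt.sub_const 1).sub
      ((hasDerivAt_id r).const_mul c)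
    exact this.congr_deriv (by simp)
  have hconv : ConvexOn ℝ (Set.uIcc s t)
      (fun r => -Real.log (Real.sigmoid r) - c / 2 * r ^ 2) := by
    refine convexOn_of_deriv2_nonneg' (convex_uIcc s t)
      (fun r _ => (hd r).differentiableAt.differentiableWithinAt) ?_ ?_
    · rw [hd1]
      exact fun r _ => (hd2 r).differentiableAt.differentiableWithinAt
    · intro r hr
      simp only [Function.iterate_succ, Function.iterate_zero, Function.comp_apply, id, hd1,
        (hd2 r).deriv]
      linarith [hc r hr]
  have h := hconv.2 Set.left_mem_uIcc Set.right_mem_uIcc 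
    (show (0 : ℝ) ≤ 1 / 2 by norm_num) (show (0 : ℝ) ≤ 1 / 2 by norm_num) (by norm_num)
  simp only [smul_eq_mul] at h
  rw [show 1 / 2 * s + 1 / 2 * t = (s + t) / 2 by ring] at h
  linarith

/-! ### Curvature of the likelihood and the distance to the MLE. -/

theorem negLogLikelihood_eq {d K : ℕ} (x : Fin K → EuclideanSpace ℝ (Fin d)) (y : Fin K → Bool)
    (θ : EuclideanSpace ℝ (Fin d)) :
    negLogLikelihood x y θ =
      ∑ k, -Real.log (Real.sigmoid (if y k then inner ℝ θ (x k) else -inner ℝ θ (x k))) := by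
  rw [negLogLikelihood, ← Finset.sum_neg_distrib]
  refine Finset.sum_congr rfl fun k _ => ?_
  split_ifs <;> rfl

theorem negLogLikelihood_midpoint_le {d K : ℕ} {c : ℝ} (x : Fin K → EuclideanSpace ℝ (Fin d))
    (y : Fin K → Bool) (θ θ' : EuclideanSpace ℝ (Fin d))
    (hc : ∀ k, ∀ r ∈ Set.uIcc (inner ℝ θ (x k)) (inner ℝ θ' (x k)), c ≤ deriv Real.sigmoid r) :
    negLogLikelihood x y ((1 / 2 : ℝ) • (θ + θ')) ≤
      (negLogLikelihood x y θ + negLogLikelihood x y θ') / 2 -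
        c / 8 * ∑ k, (inner ℝ (θ - θ') (x k)) ^ 2 := by
  simp only [negLogLikelihood_eq]
  rw [← Finset.sum_add_distrib, Finset.sum_div, Finset.mul_sum, ← Finset.sum_sub_distrib]
  refine Finset.sum_le_sum fun k _ => ?_
  simp only [inner_smul_left, inner_add_left, inner_sub_left, RCLike.conj_to_real]
  split_ifs
  · have h := neg_log_sigmoid_midpoint_le (hc k)
    rw [show (1 / 2 : ℝ) * (inner ℝ θ (x k) + inner ℝ θ' (x k)) =
      (inner ℝ θ (x k) + inner ℝ θ' (x k)) / 2 by ring]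
    exact h
  -- The label `false` reflects the argument, and `σ'` is even, so the same lower bound `c` applies.
  · have h := neg_log_sigmoid_midpoint_le (c := c) (s := -inner ℝ θ (x k))
      (t := -inner ℝ θ' (x k)) (by
        intro r hr
        rw [← deriv_sigmoid_neg]
        apply hc k
        rwa [← Set.neg_uIcc] at hr)
    rw [show -((1 / 2 : ℝ) * (inner ℝ θ (x k) + inner ℝ θ' (x k))) =
      (-inner ℝ θ (x k) + -inner ℝ θ' (x k)) / 2 by ring]
    refine h.trans (le_of_eq ?_)
    ring

theorem one_div_deriv_sigmoid_inner_le_kappa {d : ℕ} {B R : ℝ}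
    {X : Set (EuclideanSpace ℝ (Fin d))} (hR : ∀ x ∈ X, ‖x‖ ≤ R)
    {θ x : EuclideanSpace ℝ (Fin d)} (hθ : ‖θ‖ ≤ B) (hx : x ∈ X) :
    1 / deriv Real.sigmoid (inner ℝ θ x) ≤ kappa B X := by
  -- Boundedness has to be shown: the real `sSup` of an unbounded set is `0`.
  refine le_csSup ⟨2 + 2 * Real.cosh (B * R), ?_⟩ ⟨θ, x, hθ, hx, rfl⟩
  rintro r ⟨θ, x, hθ, hx, rfl⟩
  rw [one_div_deriv_sigmoid]
  have hB : 0 ≤ B := (norm_nonneg _).trans hθ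
  have h : |inner ℝ θ x| ≤ B * R := (abs_real_inner_le_norm θ x).trans
    (mul_le_mul hθ (hR x hx) (norm_nonneg _) hB)
  have := Real.cosh_le_cosh.2 (h.trans (le_abs_self _))
  linarith

theorem kappa_pos {d : ℕ} {B R : ℝ} {X : Set (EuclideanSpace ℝ (Fin d))}
    (hR : ∀ x ∈ X, ‖x‖ ≤ R) (hB : 0 ≤ B) (hX : X.Nonempty) : 0 < kappa B X := by
  obtain ⟨x, hx⟩ := hX
  exact lt_of_lt_of_le (one_div_pos.2 (deriv_sigmoid_pos _))
    (one_div_deriv_sigmoid_inner_le_kappa hR (θ := 0) (by simpa using hB) hx)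

theorem abs_inner_le_sqrt_kappa {d : ℕ} {B R : ℝ} {X : Set (EuclideanSpace ℝ (Fin d))}
    (hR : ∀ x ∈ X, ‖x‖ ≤ R) {θ x : EuclideanSpace ℝ (Fin d)} (hθ : ‖θ‖ ≤ B) (hx : x ∈ X) :
    |inner ℝ θ x| ≤ √(kappa B X) :=
  Real.abs_le_sqrt ((sq_le_one_div_deriv_sigmoid _).trans
    (one_div_deriv_sigmoid_inner_le_kappa hR hθ hx))

/-- The excess loss of a feasible parameter controls its distance to the constrained MLE in the
norm of the empirical design matrix. -/
theorem IsMLE.sum_sq_inner_sub_le {d K : ℕ} {B R : ℝ} {X : Set (EuclideanSpace ℝ (Fin d))}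
    (hR : ∀ x ∈ X, ‖x‖ ≤ R) (hX : X.Nonempty) {x : Fin K → EuclideanSpace ℝ (Fin d)}
    (hx : ∀ k, x k ∈ X) {y : Fin K → Bool} {θhat θ : EuclideanSpace ℝ (Fin d)}
    (h : IsMLE B x y θhat) (hθ : ‖θ‖ ≤ B) :
    ∑ k, (inner ℝ (θ - θhat) (x k)) ^ 2 ≤
      4 * kappa B X * (negLogLikelihood x y θ - negLogLikelihood x y θhat) := by
  have hκ : 0 < kappa B X := kappa_pos hR ((norm_nonneg _).trans hθ) hX
  have hmid : ‖(1 / 2 : ℝ) • (θ + θhat)‖ ≤ B := by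
    rw [norm_smul]
    have := norm_add_le θ θhat
    have := h.1
    norm_num
    linarith
  have h1 := h.2 _ hmid
  have h2 := negLogLikelihood_midpoint_le (c := 1 / kappa B X) x y θ θhat (by
    intro k r hr
    -- Each intermediate value is the inner product with a parameter on the segment from `θ` to
    -- `θhat`, which stays in the ball, so `κ` controls the curvature there.
    obtain ⟨θ', hθ', rfl⟩ : ∃ θ' : EuclideanSpace ℝ (Fin d), ‖θ'‖ ≤ B ∧
        inner ℝ θ' (x k) = r := by
      rw [← segment_eq_uIcc] at hr
      obtain ⟨a, b, ha, hb, hab, rfl⟩ := hr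
      refine ⟨a • θ + b • θhat, ?_, by simp [inner_add_left, inner_smul_left]⟩
      have := (convex_closedBall (0 : EuclideanSpace ℝ (Fin d)) B)
        (mem_closedBall_zero_iff.2 hθ) (mem_closedBall_zero_iff.2 h.1) ha hb hab
      exact mem_closedBall_zero_iff.1 this
    rw [one_div_le hκ (deriv_sigmoid_pos _)]
    exact one_div_deriv_sigmoid_inner_le_kappa hR hθ' (hx k))
  have h3 : 1 / kappa B X / 8 * ∑ k, (inner ℝ (θ - θhat) (x k)) ^ 2 ≤
      (negLogLikelihood x y θ - negLogLikelihood x y θhat) / 2 := by linarith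
  calc _ = 8 * kappa B X * (1 / kappa B X / 8 * ∑ k, (inner ℝ (θ - θhat) (x k)) ^ 2) := by
        field_simp
    _ ≤ 8 * kappa B X * ((negLogLikelihood x y θ - negLogLikelihood x y θhat) / 2) := by gcongr
    _ = _ := by ring

/-! ### The Shtarkov sum and the excess loss of the true parameter. -/

theorem exp_neg_negLogLikelihood {d K : ℕ} (x : Fin K → EuclideanSpace ℝ (Fin d))
    (y : Fin K → Bool) (θ : EuclideanSpace ℝ (Fin d)) :
    Real.exp (-negLogLikelihood x y θ) =
      ∏ k, Real.sigmoid (if y k then inner ℝ θ (x k) else -inner ℝ θ (x k)) := by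
  rw [negLogLikelihood_eq, ← Finset.sum_neg_distrib, Real.exp_sum]
  simp [Real.exp_log (Real.sigmoid_pos _)]

/-- For fixed `θ` the likelihoods form a product of Bernoulli laws on the label vectors. -/
theorem sum_exp_neg_negLogLikelihood {d K : ℕ} (x : Fin K → EuclideanSpace ℝ (Fin d))
    (θ : EuclideanSpace ℝ (Fin d)) :
    ∑ y : Fin K → Bool, Real.exp (-negLogLikelihood x y θ) = 1 := by
  simp only [exp_neg_negLogLikelihood]
  have h := Finset.prod_univ_sum (fun _ : Fin K => (Finset.univ : Finset Bool))
    (fun k b => Real.sigmoid (if b then inner ℝ θ (x k) else -inner ℝ θ (x k)))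
  rw [Fintype.piFinset_univ] at h
  rw [← h]
  exact Finset.prod_eq_one fun k _ => by simp [Real.sigmoid_neg]

theorem continuous_exp_neg_negLogLikelihood {d K : ℕ} (x : Fin K → EuclideanSpace ℝ (Fin d))
    (y : Fin K → Bool) : Continuous fun θ => Real.exp (-negLogLikelihood x y θ) := by
  simp only [exp_neg_negLogLikelihood]
  refine continuous_finsetProd _ fun k _ => continuous_sigmoid.comp ?_
  split_ifs <;> fun_prop

theorem exp_neg_negLogLikelihood_le {d K : ℕ} {R s : ℝ} {x : Fin K → EuclideanSpace ℝ (Fin d)}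
    (hx : ∀ k, ‖x k‖ ≤ R) (y : Fin K → Bool) {θ θ' : EuclideanSpace ℝ (Fin d)}
    (h : ‖θ - θ'‖ ≤ s) :
    Real.exp (-negLogLikelihood x y θ) ≤
      Real.exp (K * (s * R)) * Real.exp (-negLogLikelihood x y θ') := by
  have hK : Real.exp (K * (s * R)) = ∏ _k : Fin K, Real.exp (s * R) := by
    simp [Real.exp_nat_mul]
  rw [exp_neg_negLogLikelihood, exp_neg_negLogLikelihood, hK, ← Finset.prod_mul_distrib]
  refine Finset.prod_le_prod (fun k _ => Real.sigmoid_nonneg _) fun k _ => ?_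
  refine (sigmoid_le_exp_abs_sub_mul _
    (if y k then inner ℝ θ' (x k) else -inner ℝ θ' (x k))).trans ?_
  refine mul_le_mul_of_nonneg_right (Real.exp_le_exp.2 ?_) (Real.sigmoid_nonneg _)
  have h1 : |inner ℝ θ (x k) - inner ℝ θ' (x k)| ≤ s * R := by
    rw [← inner_sub_left]
    exact (abs_real_inner_le_norm _ _).trans
      (mul_le_mul h (hx k) (norm_nonneg _) ((norm_nonneg _).trans h))
  split_ifs
  · exact h1
  · rwa [neg_sub_neg, abs_sub_comm]

/-- The maximum of the likelihood over the ball is controlled by its average over the ball. -/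
theorem exp_neg_negLogLikelihood_mul_volume_le {d K : ℕ} {B R r : ℝ}
    {x : Fin K → EuclideanSpace ℝ (Fin d)} (hx : ∀ k, ‖x k‖ ≤ R) (y : Fin K → Bool)
    (hr : 0 < r) (hr1 : r ≤ 1) (hrd : K * (2 * B * r * R) ≤ d)
    {θ' : EuclideanSpace ℝ (Fin d)} (hθ' : ‖θ'‖ ≤ B) :
    Real.exp (-negLogLikelihood x y θ') *
        (r ^ d * volume.real (Metric.closedBall (0 : EuclideanSpace ℝ (Fin d)) B)) ≤
      Real.exp d * ∫ θ in Metric.closedBall (0 : EuclideanSpace ℝ (Fin d)) B,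
        Real.exp (-negLogLikelihood x y θ) := by
  set S := Metric.closedBall (0 : EuclideanSpace ℝ (Fin d)) B with hS
  -- `T` is the ball shrunk towards `θ'`: it has volume `r^d` times that of `S` and lies within
  -- `2Br` of `θ'`, so on it the likelihood drops by a factor of at most `exp (K * (2 * B * r * R))
  -- ≤ exp d`.
  set T := AffineMap.homothety θ' r '' S with hT
  have hScomp : IsCompact S := isCompact_closedBall _ _
  have hTcomp : IsCompact T := hScomp.image (AffineMap.homothety_continuous θ' r)
  have hTS : T ⊆ S := by
    rintro _ ⟨θ, hθ, rfl⟩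
    have h := (convex_closedBall (0 : EuclideanSpace ℝ (Fin d)) B)
      (mem_closedBall_zero_iff.2 hθ') hθ (sub_nonneg.2 hr1) hr.le (by ring)
    rw [AffineMap.homothety_apply, vsub_eq_sub, vadd_eq_add]
    convert h using 1
    module
  have hvol : volume.real T = r ^ d * volume.real S := by
    rw [hT, measureReal_def, Measure.addHaar_image_homothety, finrank_euclideanSpace_fin,
      ENNReal.toReal_mul, ENNReal.toReal_ofReal (abs_nonneg _), abs_of_nonneg (by positivity),
      measureReal_def]
  have hint := ((continuous_exp_neg_negLogLikelihood x y).continuousOn (s := S)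
    ).integrableOn_compact (μ := volume) hScomp
  rw [← hvol]
  have hlow : ∀ θ ∈ T, Real.exp (-d) * Real.exp (-negLogLikelihood x y θ') ≤
      Real.exp (-negLogLikelihood x y θ) := by
    rintro _ ⟨θ, hθ, rfl⟩
    have hdist : ‖θ' - AffineMap.homothety θ' r θ‖ ≤ 2 * B * r := by
      rw [AffineMap.homothety_apply, vsub_eq_sub, vadd_eq_add, sub_add_cancel_right, norm_neg,
        norm_smul, Real.norm_of_nonneg hr.le, mul_comm]
      refine mul_le_mul_of_nonneg_right ?_ hr.le
      have := mem_closedBall_zero_iff.1 hθ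
      linarith [norm_sub_le θ θ']
    have h := exp_neg_negLogLikelihood_le hx y hdist
    calc _ ≤ Real.exp (-d) * (Real.exp d *
          Real.exp (-negLogLikelihood x y (AffineMap.homothety θ' r θ))) := by
          gcongr
          refine h.trans ?_
          gcongr
      _ = _ := by rw [← mul_assoc, ← Real.exp_add]; simp
  have h1 := setIntegral_ge_of_const_le_real hTcomp.measurableSet hTcomp.measure_lt_top.ne hlow
    (hint.mono_set hTS)
  have h2 := setIntegral_mono_set hint (Filter.Eventually.of_forall fun θ => (Real.exp_pos _).le)
    hTS.eventuallyLE
  calc _ = Real.exp d * (Real.exp (-d) * Real.exp (-negLogLikelihood x y θ') *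
        volume.real T) := by
        rw [← mul_assoc, ← mul_assoc, ← Real.exp_add]; simp
    _ ≤ _ := by gcongr; exact h1.trans h2

/-- A bound on the Shtarkov sum of the Bradley--Terry model. -/
theorem sum_exp_neg_negLogLikelihood_le {d K : ℕ} {B R r : ℝ}
    {x : Fin K → EuclideanSpace ℝ (Fin d)} (hx : ∀ k, ‖x k‖ ≤ R) (hB : 0 < B)
    (hr : 0 < r) (hr1 : r ≤ 1) (hrd : K * (2 * B * r * R) ≤ d)
    {θ : (Fin K → Bool) → EuclideanSpace ℝ (Fin d)} (hθ : ∀ y, ‖θ y‖ ≤ B) :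
    (∑ y, Real.exp (-negLogLikelihood x y (θ y))) * r ^ d ≤ Real.exp d := by
  set S := Metric.closedBall (0 : EuclideanSpace ℝ (Fin d)) B
  have hS : 0 < volume.real S :=
    ENNReal.toReal_pos (Metric.measure_closedBall_pos volume _ hB).ne'
      (isCompact_closedBall _ _).measure_lt_top.ne
  refine le_of_mul_le_mul_right ?_ hS
  rw [mul_assoc, Finset.sum_mul]
  calc _ ≤ ∑ y, Real.exp d * ∫ θ in S, Real.exp (-negLogLikelihood x y θ) :=
        Finset.sum_le_sum fun y _ =>
          exp_neg_negLogLikelihood_mul_volume_le hx y hr hr1 hrd (hθ y)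
    _ = Real.exp d * ∫ θ in S, ∑ y, Real.exp (-negLogLikelihood x y θ) := by
        rw [integral_finsetSum, Finset.mul_sum]
        exact fun y _ => ((continuous_exp_neg_negLogLikelihood x y).continuousOn
          ).integrableOn_compact (isCompact_closedBall _ _)
    _ = _ := by simp [sum_exp_neg_negLogLikelihood]

theorem measureReal_labels_eq {d K : ℕ} {Ω : Type*} [MeasurableSpace Ω] {μ : Measure Ω}
    [IsProbabilityMeasure μ] {x : Fin K → EuclideanSpace ℝ (Fin d)} {y : Fin K → Ω → Bool}
    {θ : EuclideanSpace ℝ (Fin d)} (hm : ∀ k, Measurable (y k)) (hi : iIndepFun y μ)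
    (hp : ∀ k, μ.real {ω | y k ω = true} = Real.sigmoid (inner ℝ θ (x k)))
    (b : Fin K → Bool) :
    μ.real {ω | (fun k => y k ω) = b} = Real.exp (-negLogLikelihood x b θ) := by
  have h1 : {ω | (fun k => y k ω) = b} = ⋂ k ∈ Finset.univ, y k ⁻¹' {b k} := by
    ext ω
    simp [funext_iff]
  rw [h1, measureReal_def, hi.measure_inter_preimage_eq_mul Finset.univ
    (fun k _ => MeasurableSet.singleton (b k)), ENNReal.toReal_prod, exp_neg_negLogLikelihood]
  refine Finset.prod_congr rfl fun k _ => ?_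
  rw [← measureReal_def]
  have hk : MeasurableSet {ω | y k ω = true} := hm k (MeasurableSet.singleton true)
  cases hb : b k
  · have h2 : y k ⁻¹' {false} = {ω | y k ω = true}ᶜ := by
      ext ω
      simp
    rw [h2, probReal_compl_eq_one_sub hk, hp k]
    simp [Real.sigmoid_neg]
  · simp only [if_true]
    exact hp k

/-- With high probability no parameter in the ball is much more likely than the true one. -/
theorem one_sub_le_measureReal_negLogLikelihood_sub_le {d K : ℕ} {Ω : Type*} [MeasurableSpace Ω]
    {μ : Measure Ω} [IsProbabilityMeasure μ] {B R r β δ : ℝ}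
    {x : Fin K → EuclideanSpace ℝ (Fin d)} {y : Fin K → Ω → Bool}
    {θ : EuclideanSpace ℝ (Fin d)} (hm : ∀ k, Measurable (y k)) (hi : iIndepFun y μ)
    (hp : ∀ k, μ.real {ω | y k ω = true} = Real.sigmoid (inner ℝ θ (x k)))
    (hx : ∀ k, ‖x k‖ ≤ R) (hB : 0 < B) (hr : 0 < r) (hr1 : r ≤ 1)
    (hrd : K * (2 * B * r * R) ≤ d) (hβ : Real.exp (-β) * Real.exp d ≤ δ * r ^ d) :
    1 - δ ≤ μ.real {ω | ∀ θ', ‖θ'‖ ≤ B →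
      negLogLikelihood x (fun k => y k ω) θ - negLogLikelihood x (fun k => y k ω) θ' ≤ β} := by
  classical
  set Good : (Fin K → Bool) → Prop := fun b => ∀ θ', ‖θ'‖ ≤ B →
    negLogLikelihood x b θ - negLogLikelihood x b θ' ≤ β with hGood
  have hY : Measurable fun ω k => y k ω := measurable_pi_iff.2 hm
  have hmeas : MeasurableSet {ω | Good fun k => y k ω} :=
    hY (Set.toFinite {b | Good b}).measurableSet
  have hex : ∀ b, ∃ θ' : EuclideanSpace ℝ (Fin d), ‖θ'‖ ≤ B ∧
      (¬ Good b → β < negLogLikelihood x b θ - negLogLikelihood x b θ') := by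
    intro b
    by_cases hb : Good b
    · exact ⟨0, by simpa using hB.le, fun h => absurd hb h⟩
    · have hb' := hb
      simp only [hGood, not_forall, not_le] at hb'
      obtain ⟨θ', h1, h2⟩ := hb'
      exact ⟨θ', h1, fun _ => h2⟩
  choose η hη1 hη2 using hex
  have hbad : μ.real {ω | Good fun k => y k ω}ᶜ ≤ δ := by
    have hsub : {ω | Good fun k => y k ω}ᶜ ⊆
        ⋃ b ∈ Finset.univ.filter fun b => ¬ Good b, {ω | (fun k => y k ω) = b} := by
      intro ω hω
      simpa using hω
    refine (measureReal_mono hsub (measure_ne_top _ _)).trans ((measureReal_biUnion_finset_le _ _).trans ?_)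
    have hshtarkov := sum_exp_neg_negLogLikelihood_le hx hB hr hr1 hrd hη1
    calc _ = ∑ b with ¬ Good b, Real.exp (-negLogLikelihood x b θ) :=
          Finset.sum_congr rfl fun b _ => measureReal_labels_eq hm hi hp b
      _ ≤ ∑ b with ¬ Good b, Real.exp (-β) * Real.exp (-negLogLikelihood x b (η b)) := by
          refine Finset.sum_le_sum fun b hb => ?_
          rw [← Real.exp_add]
          exact Real.exp_le_exp.2 (by linarith [hη2 b (Finset.mem_filter.1 hb).2])
      _ ≤ ∑ b, Real.exp (-β) * Real.exp (-negLogLikelihood x b (η b)) :=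
          Finset.sum_le_sum_of_subset_of_nonneg (Finset.filter_subset _ _)
            fun b _ _ => by positivity
      _ = Real.exp (-β) * ∑ b, Real.exp (-negLogLikelihood x b (η b)) := by
          rw [Finset.mul_sum]
      _ ≤ δ := by
          have hrp : 0 < r ^ d := by positivity
          refine le_of_mul_le_mul_right ?_ hrp
          rw [mul_assoc]
          exact (mul_le_mul_of_nonneg_left hshtarkov (Real.exp_pos _).le).trans hβ
  have := probReal_compl_eq_one_sub (μ := μ) hmeas
  linarith

/-! ### D-optimal designs and the Kiefer–Wolfowitz bound. -/

theorem restrict_eq_self_of_measure_compl_finset {α : Type*} [MeasurableSpace α] {π : Measure α}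
    {S : Finset α} (hS : π (S : Set α)ᶜ = 0) : π.restrict (S : Set α) = π :=
  Measure.restrict_eq_self_of_ae_mem hS

theorem integrable_of_measure_compl_finset {α : Type*} [MeasurableSpace α]
    [MeasurableSingletonClass α] {π : Measure α} [IsFiniteMeasure π] {S : Finset α}
    (hS : π (S : Set α)ᶜ = 0) (f : α → ℝ) : Integrable f π := by
  have h : IntegrableOn f S π := IntegrableOn.of_finite S.finite_toSet
  rwa [IntegrableOn, restrict_eq_self_of_measure_compl_finset hS] at h

theorem designMatrix_eq_sum {d : ℕ} {π : Measure (EuclideanSpace ℝ (Fin d))} [IsFiniteMeasure π]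
    {S : Finset (EuclideanSpace ℝ (Fin d))}
    (hS : π (S : Set (EuclideanSpace ℝ (Fin d)))ᶜ = 0) :
    designMatrix π = ∑ x ∈ S, π.real {x} • Matrix.vecMulVec x.ofLp x.ofLp := by
  ext i j
  have h : ∫ x, x i * x j ∂π = ∫ x in S, x i * x j ∂π := by
    rw [restrict_eq_self_of_measure_compl_finset hS]
  rw [designMatrix, Matrix.of_apply, h,
    setIntegral_finset S (IntegrableOn.of_finite S.finite_toSet)]
  simp [Matrix.sum_apply, Matrix.vecMulVec_apply]

theorem dotProduct_designMatrix_mulVec {d : ℕ} {π : Measure (EuclideanSpace ℝ (Fin d))}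
    [IsFiniteMeasure π] {S : Finset (EuclideanSpace ℝ (Fin d))}
    (hS : π (S : Set (EuclideanSpace ℝ (Fin d)))ᶜ = 0) (w u : EuclideanSpace ℝ (Fin d)) :
    w.ofLp ⬝ᵥ (designMatrix π).mulVec u.ofLp =
      ∑ x ∈ S, π.real {x} * (inner ℝ w x * inner ℝ u x) := by
  rw [designMatrix_eq_sum hS, Matrix.sum_mulVec, dotProduct_sum]
  refine Finset.sum_congr rfl fun x _ => ?_
  rw [Matrix.smul_mulVec, Matrix.vecMulVec_mulVec, dotProduct_smul]
  simp only [EuclideanSpace.inner_eq_star_dotProduct, star_trivial, smul_eq_mul,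
    MulOpposite.smul_eq_mul_unop, MulOpposite.unop_op, dotProduct_smul]
  rw [dotProduct_comm w.ofLp]

theorem designMatrix_add_smul_dirac {d : ℕ} {π : Measure (EuclideanSpace ℝ (Fin d))}
    [IsFiniteMeasure π] {S : Finset (EuclideanSpace ℝ (Fin d))}
    (hS : π (S : Set (EuclideanSpace ℝ (Fin d)))ᶜ = 0) (v : EuclideanSpace ℝ (Fin d))
    {a b : ℝ} (ha : 0 ≤ a) (hb : 0 ≤ b) :
    designMatrix (ENNReal.ofReal a • π + ENNReal.ofReal b • Measure.dirac v) =
      a • designMatrix π + b • Matrix.vecMulVec v.ofLp v.ofLp := by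
  ext i j
  simp only [designMatrix, Matrix.of_apply, Matrix.add_apply, Matrix.smul_apply,
    Matrix.vecMulVec_apply]
  rw [integral_add_measure, integral_smul_measure, integral_smul_measure, integral_dirac,
    ENNReal.toReal_ofReal ha, ENNReal.toReal_ofReal hb]
  · exact (integrable_of_measure_compl_finset hS _).smul_measure ENNReal.ofReal_ne_top
  · exact (integrable_dirac enorm_lt_top).smul_measure ENNReal.ofReal_ne_top

theorem det_add_smul_vecMulVec_mulVec {d : ℕ} (V : Matrix (Fin d) (Fin d) ℝ) (u : Fin d → ℝ)
    (s : ℝ) :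
    (V + s • Matrix.vecMulVec (V.mulVec u) (V.mulVec u)).det =
      V.det * (1 + s * (u ⬝ᵥ V.mulVec u)) := by
  have h : V + s • Matrix.vecMulVec (V.mulVec u) (V.mulVec u) =
      V * (1 + Matrix.vecMulVec (s • u) (V.mulVec u)) := by
    rw [Matrix.mul_add, Matrix.mul_one, Matrix.mul_vecMulVec, Matrix.mulVec_smul,
      Matrix.smul_vecMulVec]
  rw [h, Matrix.det_mul, Matrix.vecMulVec_eq Unit,
    Matrix.det_one_add_replicateCol_mul_replicateRow, dotProduct_smul, dotProduct_comm,
    smul_eq_mul]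

/-- Positivity of the determinant of `ρ` is essential: `ENNReal.ofReal` collapses nonpositive
determinants to `0`. -/
theorem IsDOptimalDesign.det_le {d : ℕ} {X : Set (EuclideanSpace ℝ (Fin d))}
    {π ρ : Measure (EuclideanSpace ℝ (Fin d))} (h : IsDOptimalDesign X π)
    (hρ : IsProbabilityMeasure ρ) (hX : ρ Xᶜ = 0) (hdet : 0 < (designMatrix ρ).det) :
    (designMatrix ρ).det ≤ (designMatrix π).det := by
  have h1 := h.optimal ρ hρ hX
  rw [logDetDesign, logDetDesign, ENNReal.log_le_log_iff, ENNReal.ofReal_le_ofReal_iff'] at h1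
  exact h1.resolve_right hdet.not_ge

/-- The uniform measure on a basis chosen from `X` has design matrix `MᵀM / d`, with `M` invertible.
For `d = 0` this would be an empty average, hence not a probability measure. -/
theorem exists_designMatrix_det_pos {d : ℕ} (hd : d ≠ 0) {X : Set (EuclideanSpace ℝ (Fin d))}
    (hX : Submodule.span ℝ X = ⊤) :
    ∃ ρ : Measure (EuclideanSpace ℝ (Fin d)), IsProbabilityMeasure ρ ∧ ρ Xᶜ = 0 ∧
      0 < (designMatrix ρ).det := by
  obtain ⟨b, hb⟩ : ∃ b : Module.Basis (Fin d) ℝ (EuclideanSpace ℝ (Fin d)), ∀ i, b i ∈ X := by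
    let b₀ := Module.Basis.ofSpan hX.ge
    have := FiniteDimensional.fintypeBasisIndex b₀
    have hcard := Module.finrank_eq_card_basis b₀
    rw [finrank_euclideanSpace_fin] at hcard
    refine ⟨b₀.reindex (Fintype.equivFinOfCardEq hcard.symm), fun i => ?_⟩
    exact Module.Basis.ofSpan_subset hX.ge (by simp [b₀])
  have hd0 : (d : ENNReal) ≠ 0 := by exact_mod_cast hd
  have hdpos : (0 : ℝ) < d := by exact_mod_cast Nat.pos_of_ne_zero hd
  refine ⟨(d : ENNReal)⁻¹ • ∑ i, Measure.dirac (b i), ⟨?_⟩, ?_, ?_⟩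
  · simp [ENNReal.inv_mul_cancel hd0]
  · simp only [Measure.smul_apply, Measure.finsetSum_apply, smul_eq_mul]
    rw [Finset.sum_eq_zero, mul_zero]
    intro i _
    rw [Measure.dirac_apply]
    simp [hb i]
  · set M : Matrix (Fin d) (Fin d) ℝ := Matrix.of fun k => (b k).ofLp with hM
    have hV : designMatrix ((d : ENNReal)⁻¹ • ∑ i, Measure.dirac (b i)) =
        (d : ℝ)⁻¹ • (M.transpose * M) := by
      ext i j
      rw [designMatrix, Matrix.of_apply, integral_smul_measure,
        integral_finsetSum_measure fun k _ => integrable_dirac enorm_lt_top]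
      simp [Matrix.mul_apply, hM]
    have hMdet : M.det ≠ 0 := by
      have hli := b.linearIndependent.map'
        (WithLp.linearEquiv 2 ℝ (Fin d → ℝ)).toLinearMap (LinearEquiv.ker _)
      have := (Matrix.linearIndependent_rows_iff_isUnit (A := M)).1 hli
      exact ((Matrix.isUnit_iff_isUnit_det M).1 this).ne_zero
    rw [hV, Matrix.det_smul, Matrix.det_mul, Matrix.det_transpose]
    have := mul_self_pos.2 hMdet
    positivity

theorem IsDOptimalDesign.det_pos {d : ℕ} (hd : d ≠ 0) {X : Set (EuclideanSpace ℝ (Fin d))}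
    (hX : Submodule.span ℝ X = ⊤) {π : Measure (EuclideanSpace ℝ (Fin d))}
    (h : IsDOptimalDesign X π) : 0 < (designMatrix π).det := by
  obtain ⟨ρ, hρ, hρX, hdet⟩ := exists_designMatrix_det_pos hd hX
  exact hdet.trans_le (h.det_le hρ hρX hdet)

/-- If `1 + s g ≤ (1 + s) ^ d` for all small `s`, then `g` is at most the derivative `d`. -/
theorem le_of_one_add_mul_le_one_add_pow {g : ℝ} {d : ℕ}
    (h : ∀ s : ℝ, 0 < s → 1 + s * g ≤ (1 + s) ^ d) : g ≤ d := by
  refine le_of_forall_pos_le_add fun ε hε => ?_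
  have hd0 : (0 : ℝ) ≤ d := d.cast_nonneg
  -- With this `s`, `exp (d s) ≤ 1 + d s + (d s)²` and `(d s)² ≤ s ε`.
  obtain ⟨s, hs, hs1, hs2⟩ : ∃ s : ℝ, 0 < s ∧ d * s ≤ 1 ∧ d * d * s ≤ ε := by
    refine ⟨min 1 ε / (d * d + 1), by positivity, ?_, ?_⟩
    · rw [mul_div_assoc', div_le_one (by positivity)]
      nlinarith [min_le_left 1 ε, lt_min one_pos hε, sq_nonneg ((d : ℝ) - 1)]
    · rw [mul_div_assoc', div_le_iff₀ (by positivity)]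
      nlinarith [min_le_right 1 ε, mul_nonneg hd0 hd0]
  have h1 := h s hs
  have h2 : (1 + s) ^ d ≤ Real.exp (d * s) := by
    rw [Real.exp_nat_mul]
    exact pow_le_pow_left₀ (by linarith) (by linarith [Real.add_one_le_exp s]) d
  have hds : 0 ≤ d * s := by positivity
  have h3 := (abs_le.1 (Real.abs_exp_sub_one_sub_id_le (abs_le.2 ⟨by linarith, hs1⟩))).2
  have h4 : s * g ≤ s * (d + ε) := by nlinarith
  exact le_of_mul_le_mul_left h4 hs

/-- The Kiefer--Wolfowitz bound on the leverage of a point of the design space, in terms of a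
solution `u` of `V(π) u = v`. -/
theorem IsDOptimalDesign.dotProduct_le {d : ℕ} {X : Set (EuclideanSpace ℝ (Fin d))}
    {π : Measure (EuclideanSpace ℝ (Fin d))} (h : IsDOptimalDesign X π)
    {S : Finset (EuclideanSpace ℝ (Fin d))}
    (hS : π (S : Set (EuclideanSpace ℝ (Fin d)))ᶜ = 0) (hdet : 0 < (designMatrix π).det)
    {u v : EuclideanSpace ℝ (Fin d)} (hv : v ∈ X)
    (huv : (designMatrix π).mulVec u.ofLp = v.ofLp) :
    u.ofLp ⬝ᵥ v.ofLp ≤ d := by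
  have := h.isProbabilityMeasure
  refine le_of_one_add_mul_le_one_add_pow fun s hs => ?_
  have hs1 : 0 < (1 + s) := by linarith
  -- The competitor is `(π + s δ_v) / (1 + s)`. By the matrix determinant lemma its determinant is
  -- `det V(π)` times `(1 + s * (u ⬝ᵥ v)) / (1 + s)^d`.
  set ρ := ENNReal.ofReal (1 + s)⁻¹ • π + ENNReal.ofReal ((1 + s)⁻¹ * s) • Measure.dirac v
    with hρ
  have hρp : IsProbabilityMeasure ρ := by
    constructor
    rw [hρ]
    simp only [Measure.add_apply, Measure.smul_apply, measure_univ, smul_eq_mul, mul_one]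
    rw [← ENNReal.ofReal_add (by positivity) (by positivity), ← ENNReal.ofReal_one]
    congr 1
    field_simp
  have hρX : ρ Xᶜ = 0 := by
    rw [hρ]
    simp only [Measure.add_apply, Measure.smul_apply, h.supported, smul_eq_mul, mul_zero,
      zero_add]
    rw [Measure.dirac_apply]
    simp [hv]
  have hV : (designMatrix ρ).det =
      ((1 + s)⁻¹) ^ d * ((designMatrix π).det * (1 + s * (u.ofLp ⬝ᵥ v.ofLp))) := by
    rw [hρ, designMatrix_add_smul_dirac hS v (by positivity) (by positivity), mul_smul,
      ← smul_add, Matrix.det_smul, Fintype.card_fin, ← huv, det_add_smul_vecMulVec_mulVec]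
  by_cases hpos : 0 < 1 + s * (u.ofLp ⬝ᵥ v.ofLp)
  · have h1 := h.det_le hρp hρX (by rw [hV]; positivity)
    rw [hV, inv_pow, inv_mul_le_iff₀ (by positivity), mul_comm ((1 + s) ^ d)] at h1
    exact le_of_mul_le_mul_left h1 hdet
  · exact (not_lt.1 hpos).trans (by positivity)

/-- With `V u = v` we have `⟨w, v⟩ = wᵀ V u`. Cauchy–Schwarz in `L²(π)` leaves the factor `uᵀ V u =
⟨u, v⟩`, the leverage of `v`, which is at most `d`. -/
theorem IsDOptimalDesign.sq_inner_le {d : ℕ} (hd : d ≠ 0) {X : Set (EuclideanSpace ℝ (Fin d))}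
    (hX : Submodule.span ℝ X = ⊤) {π : Measure (EuclideanSpace ℝ (Fin d))}
    (h : IsDOptimalDesign X π) {S : Finset (EuclideanSpace ℝ (Fin d))}
    (hS : π (S : Set (EuclideanSpace ℝ (Fin d)))ᶜ = 0)
    {v : EuclideanSpace ℝ (Fin d)} (hv : v ∈ X) (w : EuclideanSpace ℝ (Fin d)) :
    (inner ℝ w v) ^ 2 ≤ d * ∑ x ∈ S, π.real {x} * (inner ℝ w x) ^ 2 := by
  have := h.isProbabilityMeasure
  have hdet := h.det_pos hd hX
  set u : EuclideanSpace ℝ (Fin d) := WithLp.toLp 2 ((designMatrix π)⁻¹.mulVec v.ofLp) with hu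
  have huv : (designMatrix π).mulVec u.ofLp = v.ofLp := by
    rw [hu, Matrix.mulVec_mulVec, Matrix.mul_nonsing_inv _ hdet.ne'.isUnit, Matrix.one_mulVec]
  have h1 : inner ℝ w v = ∑ x ∈ S, π.real {x} * (inner ℝ w x * inner ℝ u x) := by
    rw [← dotProduct_designMatrix_mulVec hS, huv, EuclideanSpace.inner_eq_star_dotProduct,
      star_trivial, dotProduct_comm]
  have h2 : ∑ x ∈ S, π.real {x} * (inner ℝ u x) ^ 2 ≤ d := by
    have h3 := dotProduct_designMatrix_mulVec hS u u
    rw [huv] at h3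
    simp only [pow_two]
    rw [← h3]
    exact h.dotProduct_le hS hdet hv huv
  rw [h1, mul_comm (d : ℝ)]
  refine (Finset.sum_sq_le_sum_mul_sum_of_sq_le_mul S
    (f := fun x => π.real {x} * (inner ℝ w x) ^ 2) (g := fun x => π.real {x} * (inner ℝ u x) ^ 2)
    (fun x _ => by positivity) (fun x _ => by positivity) (fun x _ => le_of_eq (by ring))).trans ?_
  exact mul_le_mul_of_nonneg_left h2 (Finset.sum_nonneg fun x _ => by positivity)

theorem mul_sum_le_sum_of_ceil_le_card {α : Type*} {K n : ℕ} {x : Fin K → α} {p : α → ℝ}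
    (h : ∀ a, ⌈(n : ℝ) * p a⌉₊ ≤ Nat.card {k : Fin K // x k = a}) (S : Finset α) {f : α → ℝ}
    (hf : ∀ a, 0 ≤ f a) :
    n * ∑ a ∈ S, p a * f a ≤ ∑ k, f (x k) := by
  classical
  calc (n : ℝ) * ∑ a ∈ S, p a * f a ≤
        ∑ a ∈ S, ∑ k ∈ Finset.univ.filter (fun k => x k ∈ S) with x k = a, f a := by
        rw [Finset.mul_sum]
        refine Finset.sum_le_sum fun a ha => ?_
        have h1 : ((Finset.univ.filter fun k => x k ∈ S).filter fun k => x k = a) =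
            Finset.univ.filter fun k => x k = a := by
          ext k
          simp only [Finset.mem_filter, Finset.mem_univ, true_and]
          exact ⟨fun h => h.2, fun h => ⟨h ▸ ha, h⟩⟩
        rw [h1, Finset.sum_const, nsmul_eq_mul, ← mul_assoc]
        refine mul_le_mul_of_nonneg_right ?_ (hf a)
        have h2 := h a
        rw [Nat.card_eq_fintype_card, Fintype.card_subtype] at h2
        exact (Nat.le_ceil _).trans (by exact_mod_cast h2)
    _ = ∑ k with x k ∈ S, f (x k) :=
        Finset.sum_fiberwise_of_maps_to' (fun k hk => (Finset.mem_filter.1 hk).2) f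
    _ ≤ ∑ k, f (x k) :=
        Finset.sum_le_sum_of_subset_of_nonneg (Finset.filter_subset _ _) fun k _ _ => hf _

/-! ### The confidence guarantee for one agent. -/

theorem LinearCostAssumption.norm_le_of_mem_querySpace {A : Type*} [TopologicalSpace A] {d : ℕ}
    {B L : ℝ} {θ : EuclideanSpace ℝ (Fin d)} {φ : A → EuclideanSpace ℝ (Fin d)}
    (h : LinearCostAssumption B L θ φ) : ∀ x ∈ querySpace φ, ‖x‖ ≤ 2 * L := by
  rintro _ ⟨q, rfl⟩
  refine (norm_sub_le _ _).trans ?_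
  linarith [h.norm_feature_le q.1, h.norm_feature_le q.2]

theorem LinearCostAssumption.span_querySpace {A : Type*} [TopologicalSpace A] {d : ℕ}
    {B L : ℝ} {θ : EuclideanSpace ℝ (Fin d)} {φ : A → EuclideanSpace ℝ (Fin d)}
    (h : LinearCostAssumption B L θ φ) : Submodule.span ℝ (querySpace φ) = ⊤ := by
  rw [← h.span_differences]
  congr 1
  ext x
  constructor
  · rintro ⟨q, rfl⟩
    exact ⟨q.2, q.1, rfl⟩
  · rintro ⟨a, a', rfl⟩
    exact ⟨(a', a), rfl⟩

theorem linearCost_sub_sub_linearCost_sub {A : Type*} {d : ℕ}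
    (θ θ' : EuclideanSpace ℝ (Fin d)) (φ : A → EuclideanSpace ℝ (Fin d)) (a a' : A) :
    (linearCost θ φ a - linearCost θ φ a') - (linearCost θ' φ a - linearCost θ' φ a') =
      inner ℝ (θ - θ') (queryFeature φ (a', a)) := by
  simp only [linearCost, queryFeature, inner_sub_left, inner_sub_right]
  ring

theorem errorBound_nonneg {C B L κ δ : ℝ} {d K : ℕ} (hC : 0 ≤ C) :
    0 ≤ errorBound C B L κ d K δ := by
  unfold errorBound confidenceRadius
  positivity

/-- The squared confidence radius, without the factor `κ`. -/
noncomputable def logComplexity (B L : ℝ) (d K : ℕ) (δ : ℝ) : ℝ :=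
  Real.log (1 / δ) +
    d * Real.log (max (Real.exp 1) (4 * Real.exp 1 * B * L * ((K : ℝ) - 1) / d))

/-- The floor `e` inside the maximum makes its logarithm at least `1`. This is what absorbs the
dimension when `K` is small. -/
theorem natCast_le_logComplexity {B L δ : ℝ} {d K : ℕ} (hδ : 0 < δ) (hδ1 : δ ≤ 1) :
    (d : ℝ) ≤ logComplexity B L d K δ := by
  have h1 : 0 ≤ Real.log (1 / δ) := Real.log_nonneg ((one_le_div hδ).2 hδ1)
  have h2 : 1 ≤ Real.log (max (Real.exp 1) (4 * Real.exp 1 * B * L * ((K : ℝ) - 1) / d)) := by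
    rw [Real.le_log_iff_exp_le (lt_max_of_lt_left (Real.exp_pos 1))]
    exact le_max_left _ _
  unfold logComplexity
  nlinarith [d.cast_nonneg (α := ℝ)]

theorem abs_le_errorBound {B L κ δ z : ℝ} {d K : ℕ} (hK : 0 < K)
    (h : K * z ^ 2 ≤ 16 * (κ * logComplexity B L d K δ) * d) :
    |z| ≤ errorBound 4 B L κ d K δ := by
  have hK' : (0 : ℝ) < K := by exact_mod_cast hK
  have h2 : |z| ≤ √(16 * (κ * logComplexity B L d K δ * (d / K))) := by
    refine Real.abs_le_sqrt ?_
    rw [← mul_div_assoc, ← mul_div_assoc, le_div_iff₀ hK']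
    linarith
  refine h2.trans (le_of_eq ?_)
  rw [Real.sqrt_mul (by norm_num), Real.sqrt_mul' _ (by positivity), errorBound,
    confidenceRadius, logComplexity, show (16 : ℝ) = 4 ^ 2 by norm_num,
    Real.sqrt_sq (by norm_num)]
  ring

/-- Passes from the shrinking ratio, which involves `K`, to the stated radius with `K - 1`. Since `K
≤ 2(K - 1)` and the right-hand maximum `m` satisfies `m ≥ e ≥ 2`, `e` times the left-hand maximum is
at most `m²`. -/
theorem one_add_log_max_le {B L : ℝ} {d K : ℕ} (hB : 0 ≤ B) (hL : 0 ≤ L) (hK : 2 ≤ K) :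
    1 + Real.log (max 1 (4 * B * L * K / d)) ≤
      2 * Real.log (max (Real.exp 1) (4 * Real.exp 1 * B * L * ((K : ℝ) - 1) / d)) := by
  set m := max (Real.exp 1) (4 * Real.exp 1 * B * L * ((K : ℝ) - 1) / d) with hm
  have he : 2 ≤ Real.exp 1 := by linarith [Real.add_one_le_exp (1 : ℝ)]
  have hme : Real.exp 1 ≤ m := le_max_left _ _
  have hmpos : 0 < m := by linarith
  have hK' : (2 : ℝ) ≤ K := by exact_mod_cast hK
  have hM : 0 < max 1 (4 * B * L * K / d) := lt_max_of_lt_left one_pos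
  have key : Real.exp 1 * max 1 (4 * B * L * K / d) ≤ m ^ 2 := by
    rw [mul_max_of_nonneg _ _ (by positivity)]
    refine max_le (by nlinarith) ?_
    have h1 : Real.exp 1 * (4 * B * L * K / d) ≤
        2 * (4 * Real.exp 1 * B * L * ((K : ℝ) - 1) / d) := by
      have h2 : 0 ≤ 4 * Real.exp 1 * B * L / d := by positivity
      calc _ = 4 * Real.exp 1 * B * L / d * K := by ring
        _ ≤ 4 * Real.exp 1 * B * L / d * (2 * (K - 1)) := by gcongr; linarith
        _ = _ := by ring
    have h3 : 4 * Real.exp 1 * B * L * ((K : ℝ) - 1) / d ≤ m := le_max_right _ _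
    nlinarith
  have h := Real.log_le_log (by positivity) key
  rw [Real.log_mul (by positivity) hM.ne', Real.log_exp, Real.log_pow] at h
  exact_mod_cast h

/-- The larger set need not be measurable. The final event involves `θhat`, on which no
measurability is imposed. -/
theorem le_measureReal_of_subset {Ω : Type*} [MeasurableSpace Ω] {μ : Measure Ω}
    [IsProbabilityMeasure μ] {s t : Set Ω} {c : ℝ} (h : c ≤ μ.real s) (hst : s ⊆ t) :
    c ≤ μ.real t :=
  h.trans (measureReal_mono hst)

/-- With high probability the excess negative log-likelihood of the true parameter over the whole
ball is at most twice the log-complexity. -/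
theorem one_sub_le_measureReal_excess_le_logComplexity {d K : ℕ} {Ω : Type*}
    [MeasurableSpace Ω] {μ : Measure Ω} [IsProbabilityMeasure μ] {B L δ : ℝ}
    {x : Fin K → EuclideanSpace ℝ (Fin d)} {y : Fin K → Ω → Bool}
    {θ : EuclideanSpace ℝ (Fin d)} (hm : ∀ k, Measurable (y k)) (hi : iIndepFun y μ)
    (hp : ∀ k, μ.real {ω | y k ω = true} = Real.sigmoid (inner ℝ θ (x k)))
    (hx : ∀ k, ‖x k‖ ≤ 2 * L) (hB : 0 < B) (hL : 0 ≤ L) (hd : d ≠ 0) (hK : 2 ≤ K)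
    (hδ : 0 < δ) (hδ1 : δ ≤ 1) :
    1 - δ ≤ μ.real {ω | ∀ θ', ‖θ'‖ ≤ B →
      negLogLikelihood x (fun k => y k ω) θ - negLogLikelihood x (fun k => y k ω) θ' ≤
        2 * logComplexity B L d K δ} := by
  set M := max 1 (4 * B * L * K / d) with hM
  have hM1 : 1 ≤ M := le_max_left _ _
  have hM0 : 0 < M := by linarith
  have hd' : (0 : ℝ) < d := by exact_mod_cast Nat.pos_of_ne_zero hd
  -- The ratio `r = M⁻¹` gives `r ≤ 1` and `4BLKr ≤ d`; `β` is chosen so that `exp (-β) * exp d = δ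
  -- * r^d`.
  refine le_measureReal_of_subset
    (one_sub_le_measureReal_negLogLikelihood_sub_le (r := M⁻¹)
      (β := Real.log (1 / δ) + d * (1 + Real.log M)) hm hi hp hx hB (inv_pos.2 hM0)
      (inv_le_one_of_one_le₀ hM1) ?_ ?_) ?_
  · have h1 : 4 * B * L * K / d ≤ M := le_max_right _ _
    rw [div_le_iff₀ hd'] at h1
    calc (K : ℝ) * (2 * B * M⁻¹ * (2 * L)) = (4 * B * L * K) * M⁻¹ := by ring
      _ ≤ (M * d) * M⁻¹ := by gcongr
      _ = d := by field_simp
  · rw [← Real.exp_add, one_div, Real.log_inv,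
      show -(-Real.log δ + d * (1 + Real.log M)) + d = Real.log δ + d * -Real.log M by ring,
      Real.exp_add, Real.exp_log hδ, Real.exp_nat_mul, Real.exp_neg, Real.exp_log hM0]
  · intro ω hω θ' hθ'
    refine (hω θ' hθ').trans ?_
    have h1 := one_add_log_max_le (d := d) hB.le hL hK
    have h2 : 0 ≤ Real.log (1 / δ) := Real.log_nonneg ((one_le_div hδ).2 hδ1)
    unfold logComplexity
    nlinarith

theorem one_sub_le_measureReal_costDifference_error {A Ω : Type*} [TopologicalSpace A]
    [MeasurableSpace Ω] {μ : Measure Ω} [IsProbabilityMeasure μ] {d K : ℕ} {B L δ : ℝ}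
    {θstar : EuclideanSpace ℝ (Fin d)} {φ : A → EuclideanSpace ℝ (Fin d)} {p : A → ℝ}
    {q : Fin K → A × A} {y : Fin K → Ω → Bool} {θhat : Ω → EuclideanSpace ℝ (Fin d)}
    (hK : d * (d + 1) / 2 < K) (hδ : 0 < δ) (hδ1 : δ < 1)
    (hcost : LinearCostAssumption B L θstar φ) (hq : IsDOptimalQueries φ q)
    (hp : ∀ k, p (q k).1 = p (q k).2)
    (hy : IsTruthfulFeedback μ (fun a => p a - linearCost θstar φ a) q y)
    (hθ : ∀ ω, IsMLE B (fun k => queryFeature φ (q k)) (fun k => y k ω) (θhat ω)) :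
    1 - δ ≤ μ.real {ω | ∀ a a' : A,
      |(linearCost θstar φ a - linearCost θstar φ a') -
        (linearCost (θhat ω) φ a - linearCost (θhat ω) φ a')| ≤
      errorBound 4 B L (kappa B (querySpace φ)) d K δ} := by
  -- This case absorbs `d = 0` and `B = 0`, so the ball has positive volume and `d` can be divided
  -- by afterwards.
  by_cases hdeg : ∀ ω, θhat ω = θstar
  · have huniv : {ω | ∀ a a' : A, |(linearCost θstar φ a - linearCost θstar φ a') -
        (linearCost (θhat ω) φ a - linearCost (θhat ω) φ a')| ≤
        errorBound 4 B L (kappa B (querySpace φ)) d K δ} = Set.univ := by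
      refine Set.eq_univ_of_forall fun ω a a' => ?_
      rw [hdeg ω, sub_self, abs_zero]
      exact errorBound_nonneg (by norm_num)
    rw [huniv, probReal_univ]
    linarith
  have hK0 : 0 < K := by omega
  have hd : d ≠ 0 := by
    rintro rfl
    exact hdeg fun ω => Subsingleton.elim _ _
  have hB : 0 < B := by
    refine ((norm_nonneg _).trans hcost.norm_param_le).lt_of_ne ?_
    rintro rfl
    exact hdeg fun ω => (norm_le_zero_iff.1 (hθ ω).1).trans
      (norm_le_zero_iff.1 hcost.norm_param_le).symm
  have hL : 0 ≤ L := (norm_nonneg _).trans (hcost.norm_feature_le (q ⟨0, hK0⟩).1)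
  have hK2 : 2 ≤ K := by
    have : 1 * (1 + 1) ≤ d * (d + 1) :=
      Nat.mul_le_mul (Nat.one_le_iff_ne_zero.2 hd) (by omega)
    omega
  have hR := hcost.norm_le_of_mem_querySpace
  have hmem : ∀ k, queryFeature φ (q k) ∈ querySpace φ := fun k => ⟨q k, rfl⟩
  have hprob : ∀ k, μ.real {ω | y k ω = true} =
      Real.sigmoid (inner ℝ θstar (queryFeature φ (q k))) := by
    intro k
    rw [hy.prob k, hp k]
    congr 1
    simp only [linearCost, queryFeature, inner_sub_right]
    ring
  refine le_measureReal_of_subset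
    (one_sub_le_measureReal_excess_le_logComplexity hy.measurable hy.indep hprob
      (fun k => hR _ (hmem k)) hB hL hd hK2 hδ hδ1.le) ?_
  intro ω hω a a'
  rw [linearCost_sub_sub_linearCost_sub]
  refine abs_le_errorBound hK0 ?_
  set v := queryFeature φ (a', a) with hv
  have hvX : v ∈ querySpace φ := ⟨(a', a), rfl⟩
  set G := logComplexity B L d K δ with hG
  set κ := kappa B (querySpace φ) with hκdef
  have hκ : 0 < κ := kappa_pos hR hB.le ⟨v, hvX⟩
  have hGd : (d : ℝ) ≤ G := natCast_le_logComplexity hδ hδ1.le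
  have hd' : (1 : ℝ) ≤ d := by exact_mod_cast Nat.one_le_iff_ne_zero.2 hd
  -- Above this threshold the rounding loss `d(d+1)/2` costs at most half of the queries.
  by_cases hcase : d * (d + 1) ≤ K
  · obtain ⟨π, hπ, ⟨S, -, hS⟩, hcard⟩ := hq
    have h1 := (hθ ω).sum_sq_inner_sub_le hR ⟨v, hvX⟩ hmem hcost.norm_param_le
    have h2 := hω (θhat ω) (hθ ω).1
    have h3 := mul_sum_le_sum_of_ceil_le_card hcard S
      (f := fun x => (inner ℝ (θstar - θhat ω) x) ^ 2) (fun _ => sq_nonneg _)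
    have h4 := hπ.sq_inner_le hd hcost.span_querySpace hS hvX (θstar - θhat ω)
    have h5 : (K : ℝ) ≤ 2 * ((K - d * (d + 1) / 2 : ℕ) : ℝ) := by
      have : K ≤ 2 * (K - d * (d + 1) / 2) := by omega
      exact_mod_cast this
    set n := ((K - d * (d + 1) / 2 : ℕ) : ℝ)
    calc (K : ℝ) * (inner ℝ (θstar - θhat ω) v) ^ 2
        ≤ 2 * n * (inner ℝ (θstar - θhat ω) v) ^ 2 := by gcongr
      _ ≤ 2 * n * (d * ∑ x ∈ S, π.real {x} * (inner ℝ (θstar - θhat ω) x) ^ 2) := by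
          gcongr
      _ = 2 * d * (n * ∑ x ∈ S, π.real {x} * (inner ℝ (θstar - θhat ω) x) ^ 2) := by ring
      -- The factor `2` comes from `K ≤ 2n`, `4κ` from curvature and `2G` from the excess loss; the
      -- product `16` is the square of the constant `C = 4`.
      _ ≤ 2 * d * (4 * κ * (2 * G)) := by
          refine mul_le_mul_of_nonneg_left ?_ (by positivity)
          exact (h3.trans h1).trans (mul_le_mul_of_nonneg_left h2 (by positivity))
      _ = 16 * (κ * G) * d := by ring
  -- Too few queries for the design to help: the a priori bound suffices, since `K ≤ d(d+1)` and `d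
  -- ≤ G`.
  · have h1 : |inner ℝ (θstar - θhat ω) v| ≤ 2 * √κ := by
      rw [inner_sub_left]
      refine (abs_sub _ _).trans ?_
      have := abs_inner_le_sqrt_kappa hR hcost.norm_param_le hvX
      have := abs_inner_le_sqrt_kappa hR (hθ ω).1 hvX
      linarith
    have h2 : (inner ℝ (θstar - θhat ω) v) ^ 2 ≤ 4 * κ := by
      rw [← sq_abs]
      refine (pow_le_pow_left₀ (abs_nonneg _) h1 2).trans (le_of_eq ?_)
      rw [mul_pow, Real.sq_sqrt hκ.le]
      norm_num
    have h3 : (K : ℝ) ≤ d * (d + 1) := by exact_mod_cast (not_le.1 hcase).le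
    calc (K : ℝ) * (inner ℝ (θstar - θhat ω) v) ^ 2 ≤ (4 * (d * d)) * (4 * κ) := by
          gcongr
          nlinarith
      _ ≤ (4 * (G * d)) * (4 * κ) := by gcongr
      _ = 16 * (κ * G) * d := by ring

/-! ### The rate up to logarithms. -/

theorem logComplexity_le {B L δ : ℝ} {d K : ℕ} (hB : 0 ≤ B) (hL : 0 ≤ L) (hd : 1 ≤ d)
    (hK : 2 ≤ K) (hδ : 0 < δ) (hδ2 : δ ≤ 1 / 2) :
    logComplexity B L d K δ ≤
      (8 + 4 * Real.log (1 + 4 * B * L)) * (d * Real.log (1 / δ) * Real.log K) := by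
  have hd' : (1 : ℝ) ≤ d := by exact_mod_cast hd
  have hK' : (2 : ℝ) ≤ K := by exact_mod_cast hK
  have hlog2 : 1 / 2 ≤ Real.log 2 := by linarith [Real.log_two_gt_d9]
  -- With `δ ≤ 1/2` and `K ≥ 2` both logarithms are at least `1/2`, so additive terms can be
  -- absorbed into their product at the cost of factors `2`.
  have hℓ : 1 / 2 ≤ Real.log (1 / δ) :=
    hlog2.trans (Real.log_le_log two_pos (by rw [le_div_iff₀ hδ]; linarith))
  have hk : 1 / 2 ≤ Real.log K := hlog2.trans (Real.log_le_log two_pos hK')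
  have hBL : 0 ≤ B * L := mul_nonneg hB hL
  have hc : 0 ≤ Real.log (1 + 4 * B * L) := Real.log_nonneg (by linarith)
  have hmax : max (Real.exp 1) (4 * Real.exp 1 * B * L * ((K : ℝ) - 1) / d) ≤
      Real.exp 1 * (1 + 4 * B * L) * K := by
    have he := Real.exp_pos 1
    have h1 : 0 ≤ Real.exp 1 * (B * L) := by positivity
    refine max_le (by nlinarith) ?_
    rw [div_le_iff₀ (by linarith)]
    calc 4 * Real.exp 1 * B * L * ((K : ℝ) - 1) = 4 * (Real.exp 1 * (B * L)) * (K - 1) := by ring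
      _ ≤ 4 * (Real.exp 1 * (B * L)) * K := by gcongr; linarith
      _ ≤ Real.exp 1 * (1 + 4 * B * L) * K := by nlinarith
      _ ≤ Real.exp 1 * (1 + 4 * B * L) * K * d :=
          le_mul_of_one_le_right (by nlinarith) hd'
  have hlog : Real.log (max (Real.exp 1) (4 * Real.exp 1 * B * L * ((K : ℝ) - 1) / d)) ≤
      1 + Real.log (1 + 4 * B * L) + Real.log K := by
    refine (Real.log_le_log (lt_max_of_lt_left (Real.exp_pos 1)) hmax).trans (le_of_eq ?_)
    rw [Real.log_mul (by positivity) (by positivity),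
      Real.log_mul (by positivity) (by positivity), Real.log_exp]
  unfold logComplexity
  set ℓ := Real.log (1 / δ)
  set lk := Real.log K
  set c := Real.log (1 + 4 * B * L)
  have h1 : 1 + c + lk ≤ (3 + 2 * c) * lk := by nlinarith
  have h2 : (d : ℝ) * ((3 + 2 * c) * lk) ≤ (6 + 4 * c) * (d * ℓ * lk) := by
    have : 0 ≤ (d : ℝ) * ((3 + 2 * c) * lk) := by positivity
    nlinarith
  have h3 : ℓ ≤ 2 * (d * ℓ * lk) := by
    have h4 : 1 / 2 ≤ d * lk := by nlinarith
    nlinarith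
  have h5 := mul_le_mul_of_nonneg_left (hlog.trans h1) (by linarith : (0 : ℝ) ≤ d)
  linarith

theorem exists_errorBound_le {B L : ℝ} (hB : 0 ≤ B) (hL : 0 ≤ L) : ∃ M : ℝ, 0 < M ∧
    ∀ (κ δ : ℝ) (d K : ℕ), 0 ≤ κ → d * (d + 1) / 2 < K → 0 < δ → δ ≤ 1 / 2 →
      errorBound 4 B L κ d K δ ≤
        M * √κ * (d * √(Real.log (1 / δ) / K)) * √(Real.log K) := by
  have hBL : 0 ≤ B * L := mul_nonneg hB hL
  have hc : 0 ≤ Real.log (1 + 4 * B * L) := Real.log_nonneg (by linarith)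
  refine ⟨4 * √(8 + 4 * Real.log (1 + 4 * B * L)), by positivity, ?_⟩
  intro κ δ d K hκ hK hδ hδ2
  rcases Nat.eq_zero_or_pos d with rfl | hd
  · simp [errorBound]
  have hK2 : 2 ≤ K := by
    have : 1 * (1 + 1) ≤ d * (d + 1) := Nat.mul_le_mul hd (by omega)
    omega
  have h := logComplexity_le hB hL hd hK2 hδ hδ2
  have hℓ : 0 ≤ Real.log (1 / δ) :=
    Real.log_nonneg ((one_le_div hδ).2 (by linarith))
  have hlk : 0 ≤ Real.log K := Real.log_natCast_nonneg K
  set c := 8 + 4 * Real.log (1 + 4 * B * L)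
  have hc' : 0 ≤ c := by positivity
  have hd' : (d : ℝ) = √((d : ℝ) ^ 2) := (Real.sqrt_sq d.cast_nonneg).symm
  -- Both sides become four times a single square root, which reduces the claim to the bound on
  -- `logComplexity`.
  have hrhs : 4 * √c * √κ * (d * √(Real.log (1 / δ) / K)) * √(Real.log K) =
      4 * √(c * κ * (d ^ 2 * (Real.log (1 / δ) / K)) * Real.log K) := by
    rw [Real.sqrt_mul (by positivity), Real.sqrt_mul (by positivity), Real.sqrt_mul hc',
      Real.sqrt_mul (by positivity), ← hd']
    ring
  rw [hrhs, errorBound, confidenceRadius, mul_assoc, ← Real.sqrt_mul' _ (by positivity)]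
  refine mul_le_mul_of_nonneg_left (Real.sqrt_le_sqrt ?_) (by norm_num)
  calc κ * logComplexity B L d K δ * (d / K)
      ≤ κ * (c * (d * Real.log (1 / δ) * Real.log K)) * (d / K) := by gcongr
    _ = _ := by ring

theorem lemma1 :
    ∃ C : ℝ, 0 < C ∧
      -- the confidence guarantee, for each agent and uniformly over all pairs of allocations
      (∀ (N d K : ℕ) (A : Fin N → Type*) [∀ j, TopologicalSpace (A j)]
        [∀ j, CompactSpace (A j)] (B L δ : ℝ)
        (θstar : Fin N → EuclideanSpace ℝ (Fin d))
        (φ : Fin N → (∀ j, A j) → EuclideanSpace ℝ (Fin d))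
        (p : Fin N → (∀ j, A j) → ℝ)
        (q : Fin N → Fin K → (∀ j, A j) × (∀ j, A j))
        (Ω : Type*) [MeasurableSpace Ω] (μ : Measure Ω) [IsProbabilityMeasure μ]
        (y : Fin N → Fin K → Ω → Bool)
        (θhat : Fin N → Ω → EuclideanSpace ℝ (Fin d)),
        d * (d + 1) / 2 < K → 0 < δ → δ < 1 →
        (∀ i, LinearCostAssumption B L (θstar i) (φ i)) →
        (∀ i, IsDOptimalQueries (φ i) (q i)) →
        (∀ i k, p i (q i k).1 = p i (q i k).2) →
        (∀ i, IsTruthfulFeedback μ (fun a => p i a - linearCost (θstar i) (φ i) a)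
          (q i) (y i)) →
        (∀ i ω, IsMLE B (fun k => queryFeature (φ i) (q i k)) (fun k => y i k ω)
          (θhat i ω)) →
        ∀ i, 1 - δ ≤ μ.real {ω | ∀ a a' : (∀ j, A j),
          |(linearCost (θstar i) (φ i) a - linearCost (θstar i) (φ i) a') -
            (linearCost (θhat i ω) (φ i) a - linearCost (θhat i ω) (φ i) a')| ≤
          errorBound C B L (kappa B (querySpace (φ i))) d K δ}) ∧
      -- the rate: for fixed bounds, the error bound is `d √(log(1/δ) / K)` up to a logarithm
      (∀ B L : ℝ, 0 ≤ B → 0 ≤ L → ∃ M : ℝ, 0 < M ∧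
        ∀ (κ δ : ℝ) (d K : ℕ), 0 ≤ κ → d * (d + 1) / 2 < K → 0 < δ → δ ≤ 1 / 2 →
          errorBound C B L κ d K δ ≤
            M * √κ * (d * √(Real.log (1 / δ) / K)) * √(Real.log K)) := by
  refine ⟨4, by norm_num, ?_, fun B L hB hL => exists_errorBound_le hB hL⟩
  intro N d K A _ _ B L δ θstar φ p q Ω _ μ _ y θhat hK hδ hδ1 hcost hq hp hy hθ i
  exact one_sub_le_measureReal_costDifference_error hK hδ hδ1 (hcost i) (hq i) (hp i) (hy i)
    (hθ i)
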